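/- Let $w:[0,1]^2\to[0,1]$ be a graphon, i.e. a (Lebesgue) measurable function with $w(x,y)=w(y,x)$ for almost every $(x,y)$. The graphon Laplacian $L_w$ is the bounded positive semidefinite operator on the complex Hilbert space $L^2[0,1]$ given by $L_wf(x)=\int_0^1 w(x,y)(f(x)-f(y))\,dy$. Let $\{S_1,\dots,S_k\}$ be a partition of $[0,1]$ into measurable subsets. For each $j$, let $L_j$ be the operator on $L^2(S_j)$ given by $L_jf(x)=\int_{S_j}w(x,y)(f(x)-f(y))\,dy$, let $\psi_j\in L^2(S_j)$ satisfy $\|\psi_j\|=1$ and $\int_{S_j}\psi_j\neq 0$, and let $\delta_j>0$ be such that $$\|L_j^{1/2}f\|\ge\delta_j\|f\|\quad\text{for every } f\in L^2(S_j)\text{ with }\int_{S_j}f=0 .$$ Write $|S|$ for the Lebesgue measure of $S$, and put $\theta=\max_{1\le j\le k}\dfrac{|S_j|}{|\int_{S_j}\psi_j|^2}$ and $\delta=\min_{1\le j\le k}\delta_j$. Let $0<\gamma<\delta^2/\theta$, and let $PW_\gamma(w)=\mathbf 1_{[0,\gamma]}(L_w)\,L^2[0,1]$ be the Paley–Wiener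 space, the range of the spectral projection of $L_w$ (in the sense of the Borel functional calculus) for the interval $[0,\gamma]$. Then for every $f\in PW_\gamma(w)$, $$\frac{(\delta-\sqrt{\theta\gamma})^2}{\theta\delta^2}\,\|f\|^2\;\le\;\sum_{j=1}^k|\langle f,\psi_j\rangle|^2\;\le\;\|f\|^2,$$ where $\langle f,\psi_j\rangle=\int_{S_j}f\,\overline{\psi_j}$ (that is, $\psi_j$ is extended by zero to $[0,1]$). -/

import Mathlib

open MeasureTheory Filter Topology Set
open scoped CompactlySupported InnerProductSpace

noncomputable section

namespace SpectralCalculus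

variable {H : Type*} [NormedAddCommGroup H] [InnerProductSpace ℂ H] [CompleteSpace H]

/-- For a bounded self-adjoint operator `A` and a vector `x`, the positive linear functional
`g ↦ ⟪x, g(A) x⟫` on compactly supported continuous functions `ℝ → ℝ`. -/
def spectralFunctional (A : H →L[ℂ] H) (x : H) : C_c(ℝ, ℝ) →ₚ[ℝ] ℝ :=
  PositiveLinearMap.mk₀
    { toFun := fun g => (⟪x, cfc (fun t => g t) A x⟫_ℂ).re
      map_add' := fun f g => by
        have h := cfc_add (a := A) (fun t => f t) (fun t => g t)
          f.continuous.continuousOn g.continuous.continuousOn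
        simp only [CompactlySupportedContinuousMap.coe_add, Pi.add_apply]
        rw [h]
        simp
      map_smul' := fun c g => by
        have h := cfc_smul (a := A) c (fun t => g t) g.continuous.continuousOn
        simp only [CompactlySupportedContinuousMap.coe_smul, Pi.smul_apply]
        rw [h]
        simp [inner_smul_right_eq_smul] }
    (fun g hg => by
      have h : 0 ≤ cfc (fun t => g t) A := cfc_nonneg (fun t _ => hg t)
      rw [ContinuousLinearMap.nonneg_iff_isPositive] at h
      have := h.inner_nonneg_right x
      exact (Complex.nonneg_iff.mp this).1)

/-- The (scalar) spectral measure `μ_x` of a bounded self-adjoint operator `A` at the vector `x`: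
the measure with `∫ g dμ_x = ⟪x, g(A) x⟫` for all continuous compactly supported `g`. -/
def spectralMeasure (A : H →L[ℂ] H) (x : H) : Measure ℝ :=
  RealRMK.rieszMeasure (spectralFunctional A x)

theorem spectralFunctional_apply (A : H →L[ℂ] H) (x : H) (g : C_c(ℝ, ℝ)) :
    spectralFunctional A x g = (⟪x, cfc (fun t => g t) A x⟫_ℂ).re := rfl

theorem integral_spectralMeasure (A : H →L[ℂ] H) (x : H) (g : C_c(ℝ, ℝ)) :
    ((∫ t, g t ∂(spectralMeasure A x) : ℝ) : ℂ) = ⟪x, cfc (fun t => g t) A x⟫_ℂ := by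
  rw [spectralMeasure, RealRMK.integral_rieszMeasure, spectralFunctional_apply]
  have h : IsSelfAdjoint (cfc (fun t => g t) A) := cfc_predicate _ _
  exact h.isSymmetric.coe_re_inner_self_apply x

theorem exists_bump {K : Set ℝ} (hK : IsCompact K) : ∃ g : ℕ → C_c(ℝ, ℝ),
    (∀ n t, 0 ≤ g n t ∧ g n t ≤ 1) ∧ (∀ n, ∀ t ∈ K, g n t = 1) ∧
    ∀ t, Tendsto (fun n => g n t) atTop (𝓝 (K.indicator (fun _ => (1 : ℝ)) t)) := by
  have hpos : ∀ n : ℕ, (0 : ℝ) < 1 / ((n : ℝ) + 1) := fun n => Nat.one_div_pos_of_nat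
  refine ⟨fun n => ⟨⟨fun t => (thickenedIndicator (hpos n) K t : ℝ), by fun_prop⟩, ?_⟩,
    ?_, ?_, ?_⟩
  · refine HasCompactSupport.intro (hK.cthickening (r := 1 / ((n : ℝ) + 1))) fun t ht => ?_
    have : t ∉ Metric.thickening (1 / ((n : ℝ) + 1)) K :=
      fun h => ht (Metric.thickening_subset_cthickening _ _ h)
    show ((thickenedIndicator (hpos n) K t : NNReal) : ℝ) = 0
    rw [thickenedIndicator_zero (hpos n) K this, NNReal.coe_zero]
  · exact fun n t => ⟨NNReal.coe_nonneg _, by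
      exact_mod_cast thickenedIndicator_le_one (hpos n) K t⟩
  · intro n t ht
    show ((thickenedIndicator (hpos n) K t : NNReal) : ℝ) = 1
    rw [thickenedIndicator_one (hpos n) K ht, NNReal.coe_one]
  · intro t
    have h := thickenedIndicator_tendsto_indicator_closure hpos
      tendsto_one_div_add_atTop_nhds_zero_nat K
    rw [tendsto_pi_nhds] at h
    have h2 := (NNReal.continuous_coe.tendsto _).comp (h t)
    rw [hK.isClosed.closure_eq] at h2
    have h3 : ((K.indicator (fun _ => (1 : NNReal)) t : NNReal) : ℝ)
        = K.indicator (fun _ => (1 : ℝ)) t := by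
      by_cases ht : t ∈ K <;> simp [ht]
    rw [h3] at h2
    exact h2

theorem spectralMeasure_univ_le (A : H →L[ℂ] H) (x : H) :
    spectralMeasure A x univ ≤ ENNReal.ofReal (‖x‖ ^ 2) := by
  have hU : (univ : Set ℝ) = ⋃ n : ℕ, Icc (-(n : ℝ)) n := by
    ext t
    obtain ⟨n, hn⟩ := exists_nat_ge |t|
    simp only [mem_univ, mem_iUnion, true_iff]
    exact ⟨n, abs_le.mp hn⟩
  have hmono : Monotone fun n : ℕ => Icc (-(n : ℝ)) n := fun m n h => by
    have : (m : ℝ) ≤ n := by exact_mod_cast h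
    exact Icc_subset_Icc (by linarith) this
  rw [hU, hmono.measure_iUnion]
  refine iSup_le fun n => ?_
  obtain ⟨g, h01, h1, -⟩ := exists_bump (isCompact_Icc (a := -(n : ℝ)) (b := n))
  refine (RealRMK.rieszMeasure_le_of_eq_one _ (fun t => (h01 0 t).1) isCompact_Icc
    (h1 0)).trans (ENNReal.ofReal_le_ofReal ?_)
  rw [spectralFunctional_apply]
  have h : cfc (fun t => g 0 t) A ≤ 1 := cfc_le_one _ _ fun t _ => (h01 0 t).2
  rw [ContinuousLinearMap.le_def] at h
  have h2 := (Complex.nonneg_iff.mp (h.inner_nonneg_right x)).1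
  simp only [sub_apply, inner_sub_right, one_apply_eq_self,
    Complex.sub_re] at h2
  have h3 : (⟪x, x⟫_ℂ).re = ‖x‖ ^ 2 := by
    simpa using inner_self_eq_norm_sq (𝕜 := ℂ) x
  linarith

instance (A : H →L[ℂ] H) (x : H) : IsFiniteMeasure (spectralMeasure A x) :=
  ⟨(spectralMeasure_univ_le A x).trans_lt ENNReal.ofReal_lt_top⟩

theorem exists_of_tendsto (T : ℕ → H →L[ℂ] H) (q : H → ℝ) (C : ℝ)
    (hq : ∀ x, |q x| ≤ C * ‖x‖ ^ 2)
    (h : ∀ x, Tendsto (fun n => ⟪x, T n x⟫_ℂ) atTop (𝓝 (q x : ℂ))) :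
    ∃ P : H →L[ℂ] H, ∀ x, ⟪x, P x⟫_ℂ = q x := by
  have h' : ∀ x, Tendsto (fun n => ⟪T n x, x⟫_ℂ) atTop (𝓝 (q x : ℂ)) := fun x => by
    have := (Complex.continuous_conj.tendsto _).comp (h x)
    simpa [Function.comp_def] using this
  have hlim : ∀ y x, Tendsto (fun n => ⟪T n y, x⟫_ℂ) atTop (𝓝
      (((q (x + y) : ℂ) - q (x - y) + Complex.I * q (x + Complex.I • y) -
        Complex.I * q (x - Complex.I • y)) / 4)) := fun y x => by
    have := fun n => inner_map_polarization (T n : H →ₗ[ℂ] H) x y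
    simp only [ContinuousLinearMap.coe_coe] at this
    simp_rw [this]
    exact ((((h' _).sub (h' _)).add ((h' _).const_mul _)).sub ((h' _).const_mul _)).div_const _
  choose b hb using fun y x => (⟨_, hlim y x⟩ : ∃ l, Tendsto (fun n => ⟪T n y, x⟫_ℂ) atTop (𝓝 l))
  have hbq : ∀ x, b x x = q x := fun x => tendsto_nhds_unique (hb x x) (h' x)
  have hsmul : ∀ (c : ℂ) (y x : H), b (c • y) x = star c * b y x := fun c y x =>
    tendsto_nhds_unique (hb _ _) (by
      simpa [inner_smul_left, mul_comm] using (hb y x).const_mul (star c))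
  have hsmul2 : ∀ (c : ℂ) (y x : H), b y (c • x) = c * b y x := fun c y x =>
    tendsto_nhds_unique (hb _ _) (by
      simpa [inner_smul_right, mul_comm] using (hb y x).const_mul c)
  have hb1 : ∀ y x, ‖b y x‖ ≤ C * (‖x‖ ^ 2 + ‖y‖ ^ 2) := fun y x => by
    rw [tendsto_nhds_unique (hb y x) (hlim y x)]
    have p1 := parallelogram_law_with_norm ℂ x y
    have p2 := parallelogram_law_with_norm ℂ x (Complex.I • y)
    rw [norm_smul, Complex.norm_I, one_mul] at p2
    have q1 := hq (x + y)
    have q2 := hq (x - y)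
    have q3 := hq (x + Complex.I • y)
    have q4 := hq (x - Complex.I • y)
    rw [norm_div, div_le_iff₀ (by simp)]
    have n1 := norm_sub_le ((q (x + y) : ℂ) - q (x - y) + Complex.I * q (x + Complex.I • y))
      (Complex.I * q (x - Complex.I • y))
    have n2 := norm_add_le ((q (x + y) : ℂ) - q (x - y)) (Complex.I * q (x + Complex.I • y))
    have n3 := norm_sub_le (q (x + y) : ℂ) (q (x - y))
    simp only [norm_mul, Complex.norm_I, one_mul, Complex.norm_real, Real.norm_eq_abs] at n1 n2 n3
    have : ‖(4 : ℂ)‖ = 4 := by simp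
    rw [this]
    have p1' := congrArg (C * ·) p1
    have p2' := congrArg (C * ·) p2
    simp only [mul_add] at p1' p2'
    linarith
  have hb2 : ∀ y x, ‖b y x‖ ≤ 2 * C * ‖y‖ * ‖x‖ := fun y x => by
    by_cases hy : y = 0
    · have := hsmul 0 y x
      simp_all
    by_cases hx : x = 0
    · have := hsmul2 0 y x
      simp_all
    have hy' : ‖y‖ ≠ 0 := norm_ne_zero_iff.mpr hy
    have hx' : ‖x‖ ≠ 0 := norm_ne_zero_iff.mpr hx
    have h1 := hb1 (((‖y‖⁻¹ : ℝ) : ℂ) • y) (((‖x‖⁻¹ : ℝ) : ℂ) • x)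
    rw [hsmul, hsmul2, norm_smul, norm_smul] at h1
    simp only [norm_mul, norm_star, Complex.norm_real, norm_inv, norm_norm,
      inv_mul_cancel₀ hy', inv_mul_cancel₀ hx'] at h1
    have : ‖b y x‖ = ‖y‖ * ‖x‖ * (‖y‖⁻¹ * (‖x‖⁻¹ * ‖b y x‖)) := by field_simp
    rw [this]
    calc _ ≤ ‖y‖ * ‖x‖ * (C * (1 ^ 2 + 1 ^ 2)) := by gcongr
      _ = _ := by ring
  let B₀ : H →ₗ⋆[ℂ] H →ₗ[ℂ] ℂ := LinearMap.mk₂'ₛₗ (starRingEnd ℂ) (RingHom.id ℂ) b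
    (fun y y' x => tendsto_nhds_unique (hb _ _) (by
      simpa [inner_add_left] using (hb y x).add (hb y' x)))
    (fun c y x => hsmul c y x)
    (fun y x x' => tendsto_nhds_unique (hb _ _) (by
      simpa [inner_add_right] using (hb y x).add (hb y x')))
    (fun c y x => hsmul2 c y x)
  let B : H →L⋆[ℂ] H →L[ℂ] ℂ := B₀.mkContinuous₂ (2 * C) hb2
  refine ⟨InnerProductSpace.continuousLinearMapOfBilin B, fun x => ?_⟩
  have h3 : ⟪InnerProductSpace.continuousLinearMapOfBilin B x, x⟫_ℂ = q x :=
    (InnerProductSpace.continuousLinearMapOfBilin_apply B x x).trans (hbq x)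
  rw [← inner_conj_symm, h3, Complex.conj_ofReal]

theorem exists_indicator (A : H →L[ℂ] H) {B : Set ℝ} (hB : MeasurableSet B) :
    ∃ P : H →L[ℂ] H, ∀ x, ⟪x, P x⟫_ℂ = ((spectralMeasure A x).real B : ℂ) := by
  have bound : ∀ (x : H) (B : Set ℝ), |(spectralMeasure A x).real B| ≤ 1 * ‖x‖ ^ 2 := by
    intro x B
    rw [abs_of_nonneg measureReal_nonneg, one_mul]
    exact ENNReal.toReal_le_of_le_ofReal (by positivity)
      ((measure_mono (subset_univ B)).trans (spectralMeasure_univ_le A x))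
  have lim : ∀ (B : ℕ → Set ℝ) (U : Set ℝ),
      (∀ n, ∃ P : H →L[ℂ] H, ∀ x, ⟪x, P x⟫_ℂ = ((spectralMeasure A x).real (B n) : ℂ)) →
      (∀ x, Tendsto (fun n => (spectralMeasure A x).real (B n)) atTop
        (𝓝 ((spectralMeasure A x).real U))) →
      ∃ P : H →L[ℂ] H, ∀ x, ⟪x, P x⟫_ℂ = ((spectralMeasure A x).real U : ℂ) := by
    intro B U h ht
    choose P hP using h
    refine exists_of_tendsto P _ 1 (fun x => bound x U) fun x => ?_
    simp_rw [hP]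
    exact (Complex.continuous_ofReal.tendsto _).comp (ht x)
  have hIcc : ∀ a b : ℝ, ∃ P : H →L[ℂ] H, ∀ x,
      ⟪x, P x⟫_ℂ = ((spectralMeasure A x).real (Icc a b) : ℂ) := by
    intro a b
    obtain ⟨g, h01, -, ht⟩ := exists_bump (isCompact_Icc (a := a) (b := b))
    refine exists_of_tendsto (fun n => cfc (fun t => g n t) A) _ 1 (fun x => bound x _)
      fun x => ?_
    simp_rw [← integral_spectralMeasure]
    refine (Complex.continuous_ofReal.tendsto _).comp ?_
    have h2 : (spectralMeasure A x).real (Icc a b)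
        = ∫ t, (Icc a b).indicator (fun _ => (1 : ℝ)) t ∂(spectralMeasure A x) := by
      rw [integral_indicator measurableSet_Icc]; simp
    rw [h2]
    refine tendsto_integral_of_dominated_convergence (fun _ => (1 : ℝ))
      (fun n => (g n).continuous.aestronglyMeasurable) (integrable_const _)
      (fun n => Eventually.of_forall fun t => ?_) (Eventually.of_forall ht)
    rw [Real.norm_of_nonneg (h01 n t).1]
    exact (h01 n t).2
  have huniv : ∃ P : H →L[ℂ] H, ∀ x,
      ⟪x, P x⟫_ℂ = ((spectralMeasure A x).real univ : ℂ) := by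
    refine lim (fun n => Icc (-(n : ℝ)) n) univ (fun n => hIcc _ _) fun x => ?_
    have hU : (univ : Set ℝ) = ⋃ n : ℕ, Icc (-(n : ℝ)) n := by
      ext t
      obtain ⟨n, hn⟩ := exists_nat_ge |t|
      simp only [mem_univ, mem_iUnion, true_iff]
      exact ⟨n, abs_le.mp hn⟩
    have hmono : Monotone fun n : ℕ => Icc (-(n : ℝ)) n := fun m n h => by
      have : (m : ℝ) ≤ n := by exact_mod_cast h
      exact Icc_subset_Icc (by linarith) this
    rw [hU]
    exact (ENNReal.tendsto_toReal (measure_ne_top _ _)).comp (tendsto_measure_iUnion_atTop hmono)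
  induction B, hB using MeasurableSpace.induction_on_inter
    (BorelSpace.measurable_eq.trans (borel_eq_generateFrom_Icc ℝ)) (isPiSystem_Icc id id) with
  | empty => exact ⟨0, fun x => by simp⟩
  | basic t ht =>
    obtain ⟨a, b, -, rfl⟩ := ht
    exact hIcc a b
  | compl t ht ih =>
    obtain ⟨P, hP⟩ := ih
    obtain ⟨E, hE⟩ := huniv
    refine ⟨E - P, fun x => ?_⟩
    rw [sub_apply, inner_sub_right, hP, hE, measureReal_compl ht, Complex.ofReal_sub]
  | iUnion f hd hf ih =>
    choose P hP using ih
    refine lim (fun n => ⋃ i ∈ Finset.range n, f i) _ (fun n => ⟨∑ i ∈ Finset.range n, P i,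
      fun x => ?_⟩) fun x => ?_
    · rw [measureReal_biUnion_finset (fun i _ j _ hij => hd hij) (fun i _ => hf i)]
      simp [hP]
    · have hU : (⋃ i, f i) = ⋃ n, ⋃ i ∈ Finset.range n, f i := by
        ext t
        simp only [mem_iUnion, Finset.mem_range, exists_prop]
        exact ⟨fun ⟨i, hi⟩ => ⟨i + 1, i, by omega, hi⟩, fun ⟨_, i, _, hi⟩ => ⟨i, hi⟩⟩
      have hmono : Monotone fun n : ℕ => ⋃ i ∈ Finset.range n, f i := fun m n h =>
        biUnion_subset_biUnion_left fun i hi => by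
          simp only [Finset.coe_range, mem_Iio] at hi ⊢
          exact lt_of_lt_of_le hi h
      rw [hU]
      exact (ENNReal.tendsto_toReal (measure_ne_top _ _)).comp
        (tendsto_measure_iUnion_atTop hmono)

theorem exists_borelCFC (A : H →L[ℂ] H) {g : ℝ → ℝ} (hg : Measurable g) {C : ℝ}
    (hC : ∀ t, |g t| ≤ C) :
    ∃ P : H →L[ℂ] H, ∀ x, ⟪x, P x⟫_ℂ = ((∫ t, g t ∂(spectralMeasure A x) : ℝ) : ℂ) := by
  have hs : ∀ s : SimpleFunc ℝ ℝ, ∃ P : H →L[ℂ] H, ∀ x,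
      ⟪x, P x⟫_ℂ = ((∫ t, s t ∂(spectralMeasure A x) : ℝ) : ℂ) := by
    intro s
    induction s using SimpleFunc.induction with
    | const c hs =>
      rename_i s
      obtain ⟨P, hP⟩ := exists_indicator A hs
      refine ⟨(c : ℂ) • P, fun x => ?_⟩
      have : (∫ t, (SimpleFunc.piecewise s hs (SimpleFunc.const ℝ c) (SimpleFunc.const ℝ 0)) t
          ∂(spectralMeasure A x)) = c * (spectralMeasure A x).real s := by
        simp [SimpleFunc.coe_piecewise, integral_indicator hs, mul_comm]
      rw [this, smul_apply, inner_smul_right, hP, Complex.ofReal_mul]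
    | add hd hf hg =>
      obtain ⟨P, hP⟩ := hf
      obtain ⟨Q, hQ⟩ := hg
      refine ⟨P + Q, fun x => ?_⟩
      simp only [SimpleFunc.coe_add, Pi.add_apply]
      rw [integral_add (SimpleFunc.integrable_of_isFiniteMeasure _)
        (SimpleFunc.integrable_of_isFiniteMeasure _), add_apply, inner_add_right, hP, hQ,
        Complex.ofReal_add]
  have hC0 : 0 ≤ C := (abs_nonneg _).trans (hC 0)
  choose P hP using fun n => hs (hg.stronglyMeasurable.approxBounded C n)
  refine exists_of_tendsto P _ C (fun x => ?_) fun x => ?_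
  · have h1 := norm_integral_le_of_norm_le_const (μ := spectralMeasure A x)
      (Eventually.of_forall hC : ∀ᵐ t ∂(spectralMeasure A x), ‖g t‖ ≤ C)
    refine h1.trans (mul_le_mul_of_nonneg_left ?_ hC0)
    exact ENNReal.toReal_le_of_le_ofReal (by positivity) (spectralMeasure_univ_le A x)
  · simp_rw [hP]
    refine (Complex.continuous_ofReal.tendsto _).comp ?_
    exact tendsto_integral_of_dominated_convergence (fun _ => C)
      (fun n => (SimpleFunc.measurable _).aestronglyMeasurable) (integrable_const _)
      (fun n => Eventually.of_forall fun t =>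
        hg.stronglyMeasurable.norm_approxBounded_le hC0 n t)
      (Eventually.of_forall fun t =>
        StronglyMeasurable.tendsto_approxBounded_of_norm_le _ (hC t))

open Classical in
/-- Borel functional calculus of a bounded self-adjoint operator `A`: for a bounded Borel function
`g : ℝ → ℝ`, the operator `g(A)` is the (unique) bounded operator whose quadratic form is
`⟪x, g(A) x⟫ = ∫ g dμ_x`, with `μ_x` the spectral measure of `A` at `x`; it exists by
`exists_borelCFC`. -/
def borelCFC (g : ℝ → ℝ) (A : H →L[ℂ] H) : H →L[ℂ] H :=
  if h : ∃ P : H →L[ℂ] H, ∀ x, ⟪x, P x⟫_ℂ = ((∫ t, g t ∂(spectralMeasure A x) : ℝ) : ℂ)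
  then h.choose else 0

theorem inner_borelCFC (A : H →L[ℂ] H) {g : ℝ → ℝ} (hg : Measurable g) {C : ℝ}
    (hC : ∀ t, |g t| ≤ C) (x : H) :
    ⟪x, borelCFC g A x⟫_ℂ = ((∫ t, g t ∂(spectralMeasure A x) : ℝ) : ℂ) := by
  have h := exists_borelCFC A hg hC
  rw [borelCFC, dif_pos h]
  exact h.choose_spec x

/-- The positive square root `A^{1/2}` of a positive bounded operator `A`. -/
def opSqrt (A : H →L[ℂ] H) : H →L[ℂ] H := CFC.sqrt A

end SpectralCalculus

section Laplacian

variable {X : Type*} [MeasurableSpace X] {μ : Measure X} [IsFiniteMeasure μ] {w : X × X → ℝ}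

theorem laplacian_ae_integrable (hw : AEMeasurable w (μ.prod μ))
    (hw01 : ∀ p, w p ∈ Icc (0 : ℝ) 1) (f : Lp ℂ 2 μ) :
    ∀ᵐ x ∂μ, Integrable (fun y => (w (x, y) : ℂ) * (f x - f y)) μ := by
  filter_upwards [hw.aestronglyMeasurable.prodMk_left] with x hx
  refine Integrable.bdd_mul (c := 1)
    ((integrable_const (f x)).sub ((Lp.memLp f).integrable (by norm_num)))
    (Complex.continuous_ofReal.comp_aestronglyMeasurable hx)
    (Eventually.of_forall fun y => ?_)
  rw [Complex.norm_real, Real.norm_of_nonneg (hw01 _).1]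
  exact (hw01 _).2

theorem laplacian_aestronglyMeasurable (hw : AEMeasurable w (μ.prod μ)) (f : Lp ℂ 2 μ) :
    AEStronglyMeasurable (fun x => ∫ y, (w (x, y) : ℂ) * (f x - f y) ∂μ) μ := by
  have hf : AEStronglyMeasurable f μ := (Lp.memLp f).1
  have h : AEStronglyMeasurable (fun p : X × X => (w p : ℂ) * (f p.1 - f p.2)) (μ.prod μ) :=
    (Complex.continuous_ofReal.comp_aestronglyMeasurable hw.aestronglyMeasurable).mul
      (hf.comp_fst.sub hf.comp_snd)
  exact h.integral_prod_right'

theorem eLpNorm_laplacian_le (hw01 : ∀ p, w p ∈ Icc (0 : ℝ) 1) (f : Lp ℂ 2 μ) :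
    eLpNorm (fun x => ∫ y, (w (x, y) : ℂ) * (f x - f y) ∂μ) 2 μ
      ≤ 2 * μ univ * eLpNorm f 2 μ := by
  have hfm : MemLp f 2 μ := Lp.memLp f
  have hfi : Integrable f μ := hfm.integrable (by norm_num)
  have hpt : ∀ x, ‖∫ y, (w (x, y) : ℂ) * (f x - f y) ∂μ‖
      ≤ μ.real univ * ‖f x‖ + ∫ y, ‖f y‖ ∂μ := fun x => by
    have h1 : Integrable (fun y => ‖f x‖ + ‖f y‖) μ := (integrable_const _).add hfi.norm
    refine (norm_integral_le_of_norm_le h1 (Eventually.of_forall fun y => ?_)).trans_eq ?_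
    · rw [norm_mul, Complex.norm_real, Real.norm_of_nonneg (hw01 _).1]
      calc w (x, y) * ‖f x - f y‖ ≤ 1 * ‖f x - f y‖ := by gcongr; exact (hw01 _).2
        _ ≤ _ := by rw [one_mul]; exact norm_sub_le _ _
    · rw [integral_add (integrable_const _) hfi.norm]
      simp
  have hI : ENNReal.ofReal (∫ y, ‖f y‖ ∂μ) = eLpNorm f 1 μ := by
    rw [eLpNorm_one_eq_lintegral_enorm, ofReal_integral_norm_eq_lintegral_enorm hfi]
  have hI2 : eLpNorm f 1 μ ≤ eLpNorm f 2 μ * μ univ ^ (1 / 2 : ℝ) := by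
    have := eLpNorm_le_eLpNorm_mul_rpow_measure_univ (p := 1) (q := 2) (by norm_num) hfm.1
    convert this using 3
    norm_num
  have hsq : μ univ ^ (1 / 2 : ℝ) * μ univ ^ (1 / 2 : ℝ) = μ univ := by
    rw [← ENNReal.rpow_add_of_nonneg _ _ (by norm_num) (by norm_num)]
    norm_num
  have hI0 : 0 ≤ ∫ y, ‖f y‖ ∂μ := integral_nonneg fun _ => norm_nonneg _
  calc eLpNorm (fun x => ∫ y, (w (x, y) : ℂ) * (f x - f y) ∂μ) 2 μ
      ≤ eLpNorm ((fun x => μ.real univ * ‖f x‖) + fun _ => ∫ y, ‖f y‖ ∂μ) 2 μ :=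
        eLpNorm_mono_real hpt
    _ ≤ eLpNorm (fun x => μ.real univ * ‖f x‖) 2 μ + eLpNorm (fun _ => ∫ y, ‖f y‖ ∂μ) 2 μ :=
        eLpNorm_add_le (hfm.1.norm.const_mul _) aestronglyMeasurable_const (by norm_num)
    _ ≤ μ univ * eLpNorm f 2 μ + eLpNorm f 1 μ * μ univ ^ (1 / 2 : ℝ) := by
        refine add_le_add ?_ ?_
        · have h := eLpNorm_const_smul_le (c := μ.real univ) (f := fun x => ‖f x‖) (p := 2) (μ := μ)
          refine h.trans_eq ?_
          rw [eLpNorm_norm, Real.enorm_of_nonneg measureReal_nonneg, ofReal_measureReal]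
        · refine le_of_eq ?_
          rw [eLpNorm_const' _ (by norm_num) (by norm_num), Real.enorm_of_nonneg hI0, hI]
          norm_num
    _ ≤ μ univ * eLpNorm f 2 μ + (eLpNorm f 2 μ * μ univ ^ (1 / 2 : ℝ)) * μ univ ^ (1 / 2 : ℝ) := by
        gcongr
    _ = 2 * μ univ * eLpNorm f 2 μ := by
        rw [mul_assoc (eLpNorm f 2 μ), hsq]; ring

theorem memLp_laplacian (hw : AEMeasurable w (μ.prod μ)) (hw01 : ∀ p, w p ∈ Icc (0 : ℝ) 1)
    (f : Lp ℂ 2 μ) : MemLp (fun x => ∫ y, (w (x, y) : ℂ) * (f x - f y) ∂μ) 2 μ :=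
  ⟨laplacian_aestronglyMeasurable hw f, (eLpNorm_laplacian_le hw01 f).trans_lt
    (ENNReal.mul_lt_top (ENNReal.mul_lt_top (by simp) (measure_lt_top _ _)) (Lp.memLp f).2)⟩

/-- The Laplacian of a kernel `w : X × X → [0, 1]`, a bounded operator on the complex Hilbert space
`L²(μ)`: `(L f)(x) = ∫ w(x, y) (f x - f y) dμ(y)` for almost every `x`. -/
def kernelLaplacian (μ : Measure X) [IsFiniteMeasure μ] (w : X × X → ℝ)
    (hw : AEMeasurable w (μ.prod μ)) (hw01 : ∀ p, w p ∈ Icc (0 : ℝ) 1) :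
    Lp ℂ 2 μ →L[ℂ] Lp ℂ 2 μ :=
  LinearMap.mkContinuous
    { toFun := fun f => (memLp_laplacian hw hw01 f).toLp
      map_add' := fun f g => by
        rw [← MemLp.toLp_add, MemLp.toLp_eq_toLp_iff]
        filter_upwards [Lp.coeFn_add f g, laplacian_ae_integrable hw hw01 f,
          laplacian_ae_integrable hw hw01 g] with x hx hf hg
        rw [Pi.add_apply, ← integral_add hf hg]
        refine integral_congr_ae ?_
        filter_upwards [Lp.coeFn_add f g] with y hy
        rw [hx, hy, Pi.add_apply, Pi.add_apply]
        ring
      map_smul' := fun c f => by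
        rw [RingHom.id_apply, ← MemLp.toLp_const_smul, MemLp.toLp_eq_toLp_iff]
        filter_upwards [Lp.coeFn_smul c f] with x hx
        rw [Pi.smul_apply, smul_eq_mul, ← integral_const_mul]
        refine integral_congr_ae ?_
        filter_upwards [Lp.coeFn_smul c f] with y hy
        rw [hx, hy, Pi.smul_apply, Pi.smul_apply, smul_eq_mul, smul_eq_mul]
        ring }
    (2 * μ.real univ) (fun f => by
      show ‖(memLp_laplacian hw hw01 f).toLp‖ ≤ _
      rw [Lp.norm_toLp, Lp.norm_def, Measure.real]
      have h := ENNReal.toReal_mono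
        (ENNReal.mul_lt_top (ENNReal.mul_lt_top (by simp) (measure_lt_top _ _))
          (Lp.memLp f).2).ne (eLpNorm_laplacian_le hw01 f)
      simpa [ENNReal.toReal_mul] using h)

theorem kernelLaplacian_apply_ae (hw : AEMeasurable w (μ.prod μ))
    (hw01 : ∀ p, w p ∈ Icc (0 : ℝ) 1) (f : Lp ℂ 2 μ) :
    kernelLaplacian μ w hw hw01 f =ᵐ[μ] fun x => ∫ y, (w (x, y) : ℂ) * (f x - f y) ∂μ :=
  (memLp_laplacian hw hw01 f).coeFn_toLp

end Laplacian

/-- A graphon: a (Lebesgue) measurable function `w : [0,1]² → [0,1]` with `w(x, y) = w(y, x)` for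
almost every `(x, y)`. -/
structure Graphon where
  toFun : unitInterval × unitInterval → ℝ
  aemeasurable' : AEMeasurable toFun (volume.prod volume)
  mem_Icc' : ∀ p, toFun p ∈ Icc (0 : ℝ) 1
  symm' : ∀ᵐ p ∂((volume : Measure unitInterval).prod volume), toFun p.swap = toFun p

namespace Graphon

/-- The graphon Laplacian `L_w` on `L²[0,1]`. -/
def laplacian (w : Graphon) :
    Lp ℂ 2 (volume : Measure unitInterval) →L[ℂ] Lp ℂ 2 (volume : Measure unitInterval) :=
  kernelLaplacian volume w.toFun w.aemeasurable' w.mem_Icc'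

theorem aemeasurable_restrict (w : Graphon) (S : Set unitInterval) :
    AEMeasurable w.toFun ((volume.restrict S).prod (volume.restrict S)) := by
  rw [Measure.prod_restrict]
  exact w.aemeasurable'.mono_measure Measure.restrict_le_self

/-- The Laplacian on `L²(S)` of the restriction of the graphon `w` to `S × S`. -/
def laplacianOn (w : Graphon) (S : Set unitInterval) :
    Lp ℂ 2 (volume.restrict S) →L[ℂ] Lp ℂ 2 (volume.restrict S) :=
  kernelLaplacian (volume.restrict S) w.toFun (w.aemeasurable_restrict S) w.mem_Icc'

/-- The Paley–Wiener space `PW_γ(w)`, the range of the spectral projection `1_{[0, γ]}(L_w)`. -/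
def paleyWiener (w : Graphon) (γ : ℝ) : Submodule ℂ (Lp ℂ 2 (volume : Measure unitInterval)) :=
  LinearMap.range
    (SpectralCalculus.borelCFC ((Icc 0 γ).indicator fun _ => (1 : ℝ)) w.laplacian).toLinearMap

end Graphon

end

/-! Low frequency means low energy: for `f` in the Paley–Wiener space, the Dirichlet energy ½∬
w(x,y)|f(x) − f(y)|² = ⟨f, L_w f⟩ is at most γ‖f‖². The energies of the restrictions of `f` to the
pieces `S j` only use the disjoint diagonal blocks `S j ×ˢ S j`, so together they cost at most the
energy of `f`.

On one piece, the Poincaré hypothesis makes the mean-zero part of the restriction smaller than the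
square root of its energy over `δ j`. `norm_le_sqrt_mul_norm_inner_add` trades the mean for the
sample ⟨f, ψ_j⟩: projecting onto the constants along ψ_j^⊥ instead of orthogonally costs the factor
√θ, both on the sample and on the mean-zero part.

Minkowski's inequality over the pieces then gives ‖f‖ ≤ √θ·√N + (√(θγ)/δ)‖f‖, with N the sum of the
squared samples. As √(θγ) < δ, the last term can be absorbed, and squaring gives the lower bound.
The upper bound is Cauchy–Schwarz on each piece. -/

/-! ### Oblique projection in a Hilbert space -/

/-- If `ψ` is a unit vector not orthogonal to `u`, then a vector `g` is controlled by its inner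
product with `ψ` and its component orthogonal to `u`. -/
theorem norm_le_sqrt_mul_norm_inner_add {H : Type*} [NormedAddCommGroup H] [InnerProductSpace ℂ H]
    {u ψ : H} (hψ : ‖ψ‖ = 1) (hu : ⟪u, ψ⟫_ℂ ≠ 0) (g h : H) (m : ℂ) (hg : g = h + m • u)
    (hh : ⟪u, h⟫_ℂ = 0) :
    ‖g‖ ≤ √(‖u‖ ^ 2 / ‖⟪u, ψ⟫_ℂ‖ ^ 2) * (‖⟪ψ, g⟫_ℂ‖ + ‖h‖) := by
  have hu0 : u ≠ 0 := by
    rintro rfl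
    simp at hu
  have hun : 0 < ‖u‖ := norm_pos_iff.mpr hu0
  have hd : ⟪ψ, u⟫_ℂ ≠ 0 := by rwa [Ne, inner_eq_zero_symm]
  have hhu : ⟪h, u⟫_ℂ = 0 := by rwa [inner_eq_zero_symm]
  have hns : ‖⟪u, ψ⟫_ℂ‖ = ‖⟪ψ, u⟫_ℂ‖ := norm_inner_symm _ _
  set d := ⟪ψ, u⟫_ℂ with hd_def
  have hdn : 0 < ‖d‖ := norm_pos_iff.mpr hd
  have hsq : √(‖u‖ ^ 2 / ‖⟪u, ψ⟫_ℂ‖ ^ 2) = ‖u‖ / ‖d‖ := by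
    rw [hns, ← div_pow, Real.sqrt_sq (by positivity)]
  rw [hsq]
  set e := ⟪ψ, h⟫_ℂ / d with he
  -- The splitting of `g` along `u` and ψ^⊥: `e` is chosen so that `h - e • u` is orthogonal to `ψ`.
  have hdecomp : g = (⟪ψ, g⟫_ℂ / d) • u + (h - e • u) := by
    have : ⟪ψ, g⟫_ℂ / d = e + m := by
      rw [hg, inner_add_right, inner_smul_right, ← hd_def]
      field_simp
      rw [he]
      field_simp
    rw [this, hg]
    module
  have hpyth : ‖h - e • u‖ ^ 2 = ‖h‖ ^ 2 + ‖e‖ ^ 2 * ‖u‖ ^ 2 := by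
    rw [norm_sub_sq (𝕜 := ℂ), inner_smul_right, hhu, norm_smul]
    simp [mul_pow]
  -- Since `h` is orthogonal to `u`, it only sees the component of `ψ` orthogonal to `u`. This gain
  -- over plain Cauchy–Schwarz is what makes the factor on ‖h‖ exactly ‖u‖/‖d‖.
  have hψ' : ‖⟪ψ, h⟫_ℂ‖ ^ 2 ≤ (1 - ‖d‖ ^ 2 / ‖u‖ ^ 2) * ‖h‖ ^ 2 := by
    set c : ℂ := ⟪u, ψ⟫_ℂ / (‖u‖ : ℂ) ^ 2 with hc
    have huc : (‖u‖ : ℂ) ≠ 0 := by exact_mod_cast hun.ne'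
    have h0 : ⟪u, ψ - c • u⟫_ℂ = 0 := by
      rw [inner_sub_right, inner_smul_right, inner_self_eq_norm_sq_to_K, hc]
      simp [huc]
    have h1 : ‖ψ‖ ^ 2 = ‖c • u‖ ^ 2 + ‖ψ - c • u‖ ^ 2 := by
      have := norm_add_sq (𝕜 := ℂ) (c • u) (ψ - c • u)
      rw [add_sub_cancel, inner_smul_left, h0] at this
      simpa using this
    have h2 : ‖c • u‖ ^ 2 = ‖d‖ ^ 2 / ‖u‖ ^ 2 := by
      rw [norm_smul, hc, norm_div, hns]
      simp
      field_simp
    have h3 : ⟪ψ, h⟫_ℂ = ⟪ψ - c • u, h⟫_ℂ := by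
      rw [inner_sub_left, inner_smul_left, hh]; simp
    rw [h3, show 1 - ‖d‖ ^ 2 / ‖u‖ ^ 2 = ‖ψ - c • u‖ ^ 2 by rw [hψ] at h1; linarith, ← mul_pow]
    gcongr
    exact norm_inner_le_norm _ _
  have hv : ‖h - e • u‖ ≤ ‖u‖ / ‖d‖ * ‖h‖ := by
    refine (sq_le_sq₀ (norm_nonneg _) (by positivity)).mp ?_
    rw [hpyth, he, norm_div, mul_pow]
    calc _ = ‖h‖ ^ 2 + ‖u‖ ^ 2 / ‖d‖ ^ 2 * ‖⟪ψ, h⟫_ℂ‖ ^ 2 := by ring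
      _ ≤ ‖h‖ ^ 2 + ‖u‖ ^ 2 / ‖d‖ ^ 2 * ((1 - ‖d‖ ^ 2 / ‖u‖ ^ 2) * ‖h‖ ^ 2) := by gcongr
      _ = _ := by field_simp; ring
  calc ‖g‖ ≤ ‖(⟪ψ, g⟫_ℂ / d) • u‖ + ‖h - e • u‖ := by
        conv_lhs => rw [hdecomp]
        exact norm_add_le _ _
    _ ≤ ‖⟪ψ, g⟫_ℂ‖ / ‖d‖ * ‖u‖ + ‖u‖ / ‖d‖ * ‖h‖ := by
        rw [norm_smul, norm_div]
        gcongr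
    _ = _ := by ring

/-! ### Energy on a spectral subspace -/

namespace SpectralCalculus

variable {H : Type*} [NormedAddCommGroup H] [InnerProductSpace ℂ H] [CompleteSpace H]

/-- The square root is self-adjoint and squares to `A`. This converts the Poincaré hypothesis into a
statement about energy. -/
theorem norm_opSqrt_sq {A : H →L[ℂ] H} (hA : 0 ≤ A) (x : H) :
    ‖opSqrt A x‖ ^ 2 = (⟪x, A x⟫_ℂ).re := by
  have h1 : opSqrt A * opSqrt A = A := CFC.sqrt_mul_sqrt_self A hA
  have h2 : (opSqrt A).IsPositive := by
    rw [← ContinuousLinearMap.nonneg_iff_isPositive]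
    exact CFC.sqrt_nonneg A
  conv_rhs => rw [← h1]
  have h3 : ⟪x, (opSqrt A * opSqrt A) x⟫_ℂ = ⟪opSqrt A x, opSqrt A x⟫_ℂ :=
    (h2.isSelfAdjoint.isSymmetric x _).symm
  rw [h3]
  exact (inner_self_eq_norm_sq (𝕜 := ℂ) _).symm

/-- Functions in the range of `1_[0, γ](A)` have energy at most `γ`. -/
theorem re_inner_le_of_mem_range_borelCFC {A : H →L[ℂ] H} (hA : IsSelfAdjoint A) (γ : ℝ) (x : H) :
    (⟪borelCFC ((Icc 0 γ).indicator fun _ => (1 : ℝ)) A x,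
      A (borelCFC ((Icc 0 γ).indicator fun _ => (1 : ℝ)) A x)⟫_ℂ).re
      ≤ γ * ‖borelCFC ((Icc 0 γ).indicator fun _ => (1 : ℝ)) A x‖ ^ 2 := by
  set P := borelCFC ((Icc 0 γ).indicator fun _ => (1 : ℝ)) A with hP_def
  have hP : ∀ x, ⟪x, P x⟫_ℂ =
      ((∫ t, (Icc 0 γ).indicator (fun _ => (1 : ℝ)) t ∂(spectralMeasure A x) : ℝ) : ℂ) :=
    inner_borelCFC A (measurable_const.indicator measurableSet_Icc) (C := 1) fun t => by
      by_cases ht : t ∈ Icc 0 γ <;> simp [ht]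
  have hpos : ∀ n : ℕ, (0 : ℝ) < 1 / ((n : ℝ) + 1) := fun n => Nat.one_div_pos_of_nat
  -- Continuous functions decreasing to the indicator, so that the continuous functional calculus
  -- can replace multiplicativity of the Borel one.
  let g : ℕ → C_c(ℝ, ℝ) := fun n =>
    ⟨⟨fun t => (thickenedIndicator (hpos n) (Icc 0 γ) t : ℝ), by fun_prop⟩,
      HasCompactSupport.intro (isCompact_Icc.cthickening (r := 1 / ((n : ℝ) + 1))) fun t ht => by
        have : t ∉ Metric.thickening (1 / ((n : ℝ) + 1)) (Icc 0 γ) :=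
          fun h => ht (Metric.thickening_subset_cthickening _ _ h)
        show ((thickenedIndicator (hpos n) (Icc 0 γ) t : NNReal) : ℝ) = 0
        rw [thickenedIndicator_zero (hpos n) _ this, NNReal.coe_zero]⟩
  have hg0 : ∀ n t, 0 ≤ g n t := fun n t => NNReal.coe_nonneg _
  have hg1 : ∀ n t, g n t ≤ 1 := fun n t =>
    NNReal.coe_le_coe.mpr (thickenedIndicator_le_one (hpos n) (Icc 0 γ) t)
  have hganti : ∀ m n, m ≤ n → ∀ t, g n t ≤ g m t := fun m n hmn t =>
    NNReal.coe_le_coe.mpr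
      (thickenedIndicator_mono (hpos n) (hpos m) (Nat.one_div_le_one_div hmn) (Icc 0 γ) t)
  have hgsupp : ∀ (n : ℕ) (t : ℝ), γ + 1 / ((n : ℝ) + 1) < t → g n t = 0 := fun n t ht => by
    have : t ∉ Metric.thickening (1 / ((n : ℝ) + 1)) (Icc 0 γ) := by
      rw [Metric.mem_thickening_iff]
      rintro ⟨z, hz, hd⟩
      rw [Real.dist_eq] at hd
      have := le_abs_self (t - z)
      linarith [hz.2]
    show ((thickenedIndicator (hpos n) (Icc 0 γ) t : NNReal) : ℝ) = 0
    rw [thickenedIndicator_zero (hpos n) _ this, NNReal.coe_zero]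
  have hglim : ∀ t, Tendsto (fun n => g n t) atTop
      (𝓝 ((Icc 0 γ).indicator (fun _ => (1 : ℝ)) t)) := fun t => by
    have h := thickenedIndicator_tendsto_indicator_closure hpos
      tendsto_one_div_add_atTop_nhds_zero_nat (Icc 0 γ)
    rw [tendsto_pi_nhds] at h
    have h2 := (NNReal.continuous_coe.tendsto _).comp (h t)
    rw [isClosed_Icc.closure_eq] at h2
    have h3 : (((Icc 0 γ).indicator (fun _ => (1 : NNReal)) t : NNReal) : ℝ)
        = (Icc 0 γ).indicator (fun _ => (1 : ℝ)) t := by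
      by_cases ht : t ∈ Icc 0 γ <;> simp [ht]
    rwa [h3] at h2
  let T : ℕ → H →L[ℂ] H := fun n => cfc (fun t => g n t) A
  have hTsa : ∀ n, IsSelfAdjoint (T n) := fun n => cfc_predicate _ _
  have hgc : ∀ n, ContinuousOn (fun t => g n t) (spectrum ℝ A) :=
    fun n => (g n).continuous.continuousOn
  have hTlim : ∀ x, Tendsto (fun n => ⟪x, T n x⟫_ℂ) atTop (𝓝 ⟪x, P x⟫_ℂ) := fun x => by
    rw [hP]
    simp_rw [T, ← integral_spectralMeasure]
    refine (Complex.continuous_ofReal.tendsto _).comp ?_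
    refine tendsto_integral_of_dominated_convergence (fun _ => (1 : ℝ))
      (fun n => (g n).continuous.aestronglyMeasurable) (integrable_const _)
      (fun n => Eventually.of_forall fun t => ?_) (Eventually.of_forall hglim)
    rw [Real.norm_of_nonneg (hg0 n t)]
    exact hg1 n t
  -- Convergence of the quadratic forms gives weak operator convergence by polarization.
  have hTweak : ∀ y x, Tendsto (fun n => ⟪T n y, x⟫_ℂ) atTop (𝓝 ⟪P y, x⟫_ℂ) := fun y x => by
    have h' : ∀ x, Tendsto (fun n => ⟪T n x, x⟫_ℂ) atTop (𝓝 ⟪P x, x⟫_ℂ) := fun x => by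
      simpa [Function.comp_def] using (Complex.continuous_conj.tendsto _).comp (hTlim x)
    have h1 := fun n => inner_map_polarization (T n : H →ₗ[ℂ] H) x y
    have h2 := inner_map_polarization (P : H →ₗ[ℂ] H) x y
    simp only [ContinuousLinearMap.coe_coe] at h1 h2
    simp_rw [h1, h2]
    exact ((((h' _).sub (h' _)).add ((h' _).const_mul _)).sub ((h' _).const_mul _)).div_const _
  have hself : ∀ y : H, (⟪y, y⟫_ℂ).re = ‖y‖ ^ 2 := inner_self_eq_norm_sq (𝕜 := ℂ)
  -- Monotonicity upgrades weak to strong convergence, which the energy form needs: 0 ≤ g_m − g_n ≤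
  -- 1 gives (g_m − g_n)² ≤ g_m − g_n, hence the same for the operators.
  have hsqle : ∀ m n, m ≤ n → ‖T m x - T n x‖ ^ 2 ≤
      (⟪x, T m x⟫_ℂ).re - (⟪x, T n x⟫_ℂ).re := fun m n hmn => by
    have h1 : (T m - T n) * (T m - T n) ≤ T m - T n := by
      rw [← cfc_sub _ _ A (hgc m) (hgc n), ← cfc_mul (fun t => g m t - g n t)
        (fun t => g m t - g n t) A ((hgc m).sub (hgc n)) ((hgc m).sub (hgc n))]
      refine cfc_mono (fun t _ => ?_) (((hgc m).sub (hgc n)).mul ((hgc m).sub (hgc n)))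
        ((hgc m).sub (hgc n))
      have := hganti m n hmn t
      have := hg0 n t
      have := hg1 m t
      show (g m t - g n t) * (g m t - g n t) ≤ g m t - g n t
      nlinarith
    rw [ContinuousLinearMap.le_def] at h1
    have h2 := (Complex.nonneg_iff.mp (h1.inner_nonneg_right x)).1
    have h3 : ⟪x, ((T m - T n) * (T m - T n)) x⟫_ℂ = ⟪(T m - T n) x, (T m - T n) x⟫_ℂ :=
      (((hTsa m).sub (hTsa n)).isSymmetric x _).symm
    rw [sub_apply, inner_sub_right, h3, Complex.sub_re, hself] at h2
    simp only [sub_apply, inner_sub_right, Complex.sub_re] at h2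
    linarith
  have hTstrong : Tendsto (fun n => T n x) atTop (𝓝 (P x)) := by
    have hc : CauchySeq fun n => T n x := by
      have hre : CauchySeq fun n => (⟪x, T n x⟫_ℂ).re :=
        ((Complex.continuous_re.tendsto _).comp (hTlim x)).cauchySeq
      rw [Metric.cauchySeq_iff'] at hre ⊢
      intro ε hε
      obtain ⟨N, hN⟩ := hre (ε ^ 2) (by positivity)
      refine ⟨N, fun n hn => ?_⟩
      have h1 := hsqle N n hn
      have h2 := hN n hn
      rw [Real.dist_eq, abs_sub_comm] at h2
      have h3 := (h1.trans (le_abs_self _)).trans_lt h2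
      rw [dist_comm, dist_eq_norm]
      exact lt_of_pow_lt_pow_left₀ 2 hε.le h3
    obtain ⟨q, hq⟩ := cauchySeq_tendsto_of_complete hc
    -- The strong limit is also the weak limit.
    have : q = P x := ext_inner_right ℂ fun y =>
      tendsto_nhds_unique (hq.inner tendsto_const_nhds) (hTweak x y)
    rwa [this] at hq
  -- Pointwise t·g_n(t)² ≤ c·g_n(t)², because g_n vanishes beyond `c`.
  have hbound : ∀ n : ℕ, (⟪T n x, A (T n x)⟫_ℂ).re ≤ (γ + 1 / ((n : ℝ) + 1)) * ‖T n x‖ ^ 2 := by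
    intro n
    set c := γ + 1 / ((n : ℝ) + 1) with hc
    have h1 : T n * (A * T n) ≤ c • (T n * T n) := by
      have e1 : T n * (A * T n) = cfc (fun t => g n t * (t * g n t)) A := by
        rw [cfc_mul (fun t => g n t) (fun t => t * g n t) A (hgc n) (continuousOn_id.mul (hgc n)),
          cfc_mul (fun t => t) (fun t => g n t) A continuousOn_id (hgc n), cfc_id' ℝ A]
      have e2 : c • (T n * T n) = cfc (fun t => c • (g n t * g n t)) A := by
        rw [cfc_smul c (fun t => g n t * g n t) A ((hgc n).mul (hgc n)),
          cfc_mul _ _ A (hgc n) (hgc n)]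
      rw [e1, e2]
      refine cfc_mono (fun t _ => ?_) ((hgc n).mul (continuousOn_id.mul (hgc n)))
        (((hgc n).mul (hgc n)).const_smul c)
      rcases le_or_gt t c with h | h
      · have := mul_self_nonneg (g n t)
        simp only [smul_eq_mul]
        nlinarith
      · simp [hgsupp n t h]
    rw [ContinuousLinearMap.le_def] at h1
    have h2 := (Complex.nonneg_iff.mp (h1.inner_nonneg_right x)).1
    have h3 : ⟪x, (T n * (A * T n)) x⟫_ℂ = ⟪T n x, A (T n x)⟫_ℂ := ((hTsa n).isSymmetric x _).symm
    have h4 : ⟪x, (c • (T n * T n)) x⟫_ℂ = c • ⟪T n x, T n x⟫_ℂ := by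
      rw [smul_apply, inner_smul_right_eq_smul]
      exact congrArg (c • ·) ((hTsa n).isSymmetric x _).symm
    rw [sub_apply, inner_sub_right, h3, h4, Complex.sub_re, Complex.smul_re, hself, smul_eq_mul] at h2
    linarith
  have hAT := (Complex.continuous_re.tendsto _).comp
    (hTstrong.inner (𝕜 := ℂ) ((A.continuous.tendsto _).comp hTstrong))
  refine le_of_tendsto_of_tendsto' hAT ?_ hbound
  have := (tendsto_const_nhds (x := γ)).add (tendsto_one_div_add_atTop_nhds_zero_nat (𝕜 := ℝ))
  rw [add_zero] at this
  exact this.mul (hTstrong.norm.pow 2)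

end SpectralCalculus

/-! ### Dirichlet energy of a kernel Laplacian -/

theorem L2_norm_sq_eq_integral {X : Type*} [MeasurableSpace X] {μ : Measure X} (f : Lp ℂ 2 μ) :
    ‖f‖ ^ 2 = ∫ x, ‖f x‖ ^ 2 ∂μ := by
  have h : ⟪f, f⟫_ℂ = ((∫ x, ‖f x‖ ^ 2 ∂μ : ℝ) : ℂ) := by
    rw [L2.inner_def, ← integral_complex_ofReal]
    refine integral_congr_ae (Eventually.of_forall fun x => ?_)
    simp [inner_self_eq_norm_sq_to_K]
  rw [← inner_self_eq_norm_sq (𝕜 := ℂ), h]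
  simp

section Energy

variable {X : Type*} [MeasurableSpace X] {μ : Measure X} [IsFiniteMeasure μ] {w : X × X → ℝ}

theorem integrable_energy (hw : AEMeasurable w (μ.prod μ)) (hw01 : ∀ p, w p ∈ Icc (0 : ℝ) 1)
    {f : X → ℂ} (hf : MemLp f 2 μ) :
    Integrable (fun p : X × X => w p * ‖f p.1 - f p.2‖ ^ 2) (μ.prod μ) := by
  have h : MemLp (fun p : X × X => f p.1 - f p.2) 2 (μ.prod μ) :=
    (hf.comp_fst μ).sub (hf.comp_snd μ)
  refine Integrable.bdd_mul (c := 1) ((memLp_two_iff_integrable_sq_norm h.1).mp h)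
    hw.aestronglyMeasurable (Eventually.of_forall fun p => ?_)
  rw [Real.norm_of_nonneg (hw01 _).1]
  exact (hw01 _).2

/-- The quadratic form of the Laplacian of a symmetric kernel is its Dirichlet energy. -/
theorem inner_kernelLaplacian_self (hw : AEMeasurable w (μ.prod μ))
    (hw01 : ∀ p, w p ∈ Icc (0 : ℝ) 1) (hsymm : ∀ᵐ p ∂μ.prod μ, w p.swap = w p) (f : Lp ℂ 2 μ) :
    ⟪f, kernelLaplacian μ w hw hw01 f⟫_ℂ =
      (((∫ p, w p * ‖f p.1 - f p.2‖ ^ 2 ∂μ.prod μ) / 2 : ℝ) : ℂ) := by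
  have hf : MemLp f 2 μ := Lp.memLp f
  let F : X × X → ℂ := fun p => (w p : ℂ) * (f p.1 - f p.2) * starRingEnd ℂ (f p.1)
  have hF : Integrable F (μ.prod μ) := by
    have h1 : MemLp (fun p : X × X => f p.1 - f p.2) 2 (μ.prod μ) :=
      (hf.comp_fst μ).sub (hf.comp_snd μ)
    have h2 : MemLp (fun p : X × X => starRingEnd ℂ (f p.1)) 2 (μ.prod μ) := (hf.comp_fst μ).star
    have h3 : Integrable (fun p : X × X => (f p.1 - f p.2) * starRingEnd ℂ (f p.1)) (μ.prod μ) :=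
      h1.integrable_mul h2
    simp only [F, mul_assoc]
    refine Integrable.bdd_mul (c := 1) h3
      (Complex.continuous_ofReal.comp_aestronglyMeasurable hw.aestronglyMeasurable)
      (Eventually.of_forall fun p => ?_)
    rw [Complex.norm_real, Real.norm_of_nonneg (hw01 _).1]
    exact (hw01 _).2
  have h1 : ⟪f, kernelLaplacian μ w hw hw01 f⟫_ℂ = ∫ p, F p ∂μ.prod μ := by
    rw [L2.inner_def, integral_prod F hF]
    refine integral_congr_ae ?_
    filter_upwards [kernelLaplacian_apply_ae hw hw01 f] with x hx
    rw [hx, RCLike.inner_apply, ← integral_mul_const]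
  have h2 : ∫ p, F p ∂μ.prod μ = ∫ p, F p.swap ∂μ.prod μ := (integral_prod_swap F).symm
  -- Symmetrization: by symmetry of `w`, averaging `F` with its swap turns (f(x) − f(y))·conj f(x)
  -- into half of |f(x) − f(y)|².
  have h3 : ∫ p, F p ∂μ.prod μ + ∫ p, F p.swap ∂μ.prod μ =
      ((∫ p, w p * ‖f p.1 - f p.2‖ ^ 2 ∂μ.prod μ : ℝ) : ℂ) := by
    have hF' : Integrable (fun p : X × X => F p.swap) (μ.prod μ) := hF.swap
    rw [← integral_add hF hF', ← integral_complex_ofReal]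
    refine integral_congr_ae ?_
    filter_upwards [hsymm] with p hp
    simp only [F, hp, Prod.fst_swap, Prod.snd_swap]
    push_cast
    rw [← Complex.mul_conj', map_sub]
    ring
  rw [h1]
  rw [← h2] at h3
  push_cast
  linear_combination h3 / 2

/-- The quadratic form is an energy with a nonnegative weight. Positivity is what makes the square
root meaningful and the operator self-adjoint. -/
theorem kernelLaplacian_nonneg (hw : AEMeasurable w (μ.prod μ))
    (hw01 : ∀ p, w p ∈ Icc (0 : ℝ) 1) (hsymm : ∀ᵐ p ∂μ.prod μ, w p.swap = w p) :
    0 ≤ kernelLaplacian μ w hw hw01 := by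
  rw [ContinuousLinearMap.nonneg_iff_isPositive, ContinuousLinearMap.isPositive_iff_complex]
  intro f
  have h := inner_kernelLaplacian_self hw hw01 hsymm f
  have h' : ⟪kernelLaplacian μ w hw hw01 f, f⟫_ℂ =
      (((∫ p, w p * ‖f p.1 - f p.2‖ ^ 2 ∂μ.prod μ) / 2 : ℝ) : ℂ) := by
    rw [← inner_conj_symm, h, Complex.conj_ofReal]
  rw [h']
  refine ⟨by simp, ?_⟩
  have : 0 ≤ ∫ p, w p * ‖f p.1 - f p.2‖ ^ 2 ∂μ.prod μ :=
    integral_nonneg fun p => mul_nonneg (hw01 p).1 (by positivity)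
  simp
  positivity

/-- A unit vector `ψ` of nonzero mean and a Poincaré inequality with constant `δ` control every
function by its inner product with `ψ` and its energy. -/
theorem norm_le_of_poincare (hw : AEMeasurable w (μ.prod μ))
    (hw01 : ∀ p, w p ∈ Icc (0 : ℝ) 1) (hsymm : ∀ᵐ p ∂μ.prod μ, w p.swap = w p)
    {δ : ℝ} (hδ0 : 0 < δ) (hδ : ∀ f : Lp ℂ 2 μ, ∫ x, f x ∂μ = 0 →
      δ * ‖f‖ ≤ ‖SpectralCalculus.opSqrt (kernelLaplacian μ w hw hw01) f‖)
    {ψ : Lp ℂ 2 μ} (hψ : ‖ψ‖ = 1) (hψ0 : ∫ x, ψ x ∂μ ≠ 0) (g : Lp ℂ 2 μ) :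
    ‖g‖ ≤ √(μ.real univ / ‖∫ x, ψ x ∂μ‖ ^ 2) * (‖⟪ψ, g⟫_ℂ‖ +
      √((∫ p, w p * ‖g p.1 - g p.2‖ ^ 2 ∂μ.prod μ) / 2) / δ) := by
  -- The constant function 1: inner products with it are integrals, and its squared norm is the
  -- total mass.
  let u : Lp ℂ 2 μ := (memLp_const (1 : ℂ)).toLp
  have hu : u =ᵐ[μ] fun _ => (1 : ℂ) := MemLp.coeFn_toLp _
  have hinner : ∀ f : Lp ℂ 2 μ, ⟪u, f⟫_ℂ = ∫ x, f x ∂μ := fun f => by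
    rw [L2.inner_def]
    refine integral_congr_ae ?_
    filter_upwards [hu] with x hx
    simp [hx]
  have hunorm : ‖u‖ ^ 2 = μ.real univ := by
    rw [L2_norm_sq_eq_integral, integral_congr_ae (g := fun _ => (1 : ℝ))]
    · simp
    · filter_upwards [hu] with x hx
      simp [hx]
  have huψ : ⟪u, ψ⟫_ℂ ≠ 0 := by rwa [hinner]
  have huc : (‖u‖ : ℂ) ≠ 0 := by
    rw [Ne, Complex.ofReal_eq_zero, norm_eq_zero]
    intro h
    simp [h] at huψ
  let m : ℂ := ⟪u, g⟫_ℂ / (‖u‖ : ℂ) ^ 2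
  let h : Lp ℂ 2 μ := g - m • u
  have hh : ⟪u, h⟫_ℂ = 0 := by
    simp only [h, inner_sub_right, inner_smul_right, inner_self_eq_norm_sq_to_K, m]
    simp [huc]
  have hae : h =ᵐ[μ] fun x => g x - m := by
    filter_upwards [Lp.coeFn_sub g (m • u), Lp.coeFn_smul m u, hu] with x h1 h2 h3
    rw [h1, Pi.sub_apply, h2, Pi.smul_apply, h3]
    simp
  -- Subtracting the mean leaves every difference unchanged, hence the energy too.
  have hE : ∫ p, w p * ‖h p.1 - h p.2‖ ^ 2 ∂μ.prod μ = ∫ p, w p * ‖g p.1 - g p.2‖ ^ 2 ∂μ.prod μ := by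
    refine integral_congr_ae ?_
    filter_upwards [Measure.quasiMeasurePreserving_fst.ae hae,
      Measure.quasiMeasurePreserving_snd.ae hae] with p h1 h2
    simp only [h1, h2, sub_sub_sub_cancel_right]
  have h1 := hδ h (by rw [← hinner, hh])
  have h2 := SpectralCalculus.norm_opSqrt_sq (kernelLaplacian_nonneg hw hw01 hsymm) h
  rw [inner_kernelLaplacian_self hw hw01 hsymm, hE, Complex.ofReal_re] at h2
  rw [← h2, Real.sqrt_sq (norm_nonneg _)]
  have h3 := norm_le_sqrt_mul_norm_inner_add hψ huψ g h m (by simp [h]) hh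
  rw [hunorm, hinner] at h3
  refine h3.trans ?_
  gcongr
  rw [le_div_iff₀ hδ0]
  linarith

end Energy

/-! ### Summation over the pieces -/

theorem sum_setIntegral_le {X ι : Type*} [MeasurableSpace X] [Fintype ι] {μ : Measure X}
    {s : ι → Set X} (hm : ∀ i, NullMeasurableSet (s i) μ)
    (hd : Pairwise fun i j => Disjoint (s i) (s j))
    {h : X → ℝ} (h0 : ∀ x, 0 ≤ h x) (hi : Integrable h μ) :
    ∑ i, ∫ x in s i, h x ∂μ ≤ ∫ x, h x ∂μ := by
  rw [← tsum_fintype (L := .unconditional ι),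
    ← integral_iUnion_ae hm (fun i j hij => (hd hij).aedisjoint) hi.integrableOn]
  exact setIntegral_le_integral hi (Eventually.of_forall h0)

/-- The triangle inequality in Euclidean space. -/
theorem sum_sq_add_le_sqrt {ι : Type*} [Fintype ι] (p q : ι → ℝ) :
    √(∑ i, (p i + q i) ^ 2) ≤ √(∑ i, p i ^ 2) + √(∑ i, q i ^ 2) := by
  have := norm_add_le (WithLp.toLp 2 p : EuclideanSpace ℝ ι) (WithLp.toLp 2 q)
  simpa [EuclideanSpace.norm_eq] using this

/-! ### Graphons and the sampling inequality -/

theorem Graphon.symm_restrict (w : Graphon) (S : Set unitInterval) :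
    ∀ᵐ p ∂((volume : Measure unitInterval).restrict S).prod (volume.restrict S),
      w.toFun p.swap = w.toFun p := by
  rw [Measure.prod_restrict]
  exact ae_restrict_of_ae w.symm'

theorem Graphon.energy_le_of_mem_paleyWiener (w : Graphon) {γ : ℝ}
    {f : Lp ℂ 2 (volume : Measure unitInterval)} (hf : f ∈ w.paleyWiener γ) :
    (∫ p, w.toFun p * ‖f p.1 - f p.2‖ ^ 2 ∂(volume : Measure unitInterval).prod volume) / 2
      ≤ γ * ‖f‖ ^ 2 := by
  obtain ⟨x, rfl⟩ := hf
  have hsa : IsSelfAdjoint w.laplacian :=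
    (kernelLaplacian_nonneg w.aemeasurable' w.mem_Icc' w.symm').isSelfAdjoint
  have h := SpectralCalculus.re_inner_le_of_mem_range_borelCFC hsa γ x
  rw [Graphon.laplacian, inner_kernelLaplacian_self _ _ w.symm', Complex.ofReal_re] at h
  exact h

theorem mainTheorem3 (w : Graphon) {k : ℕ} (S : Fin k → Set unitInterval)
    (hS_meas : ∀ j, NullMeasurableSet (S j) volume)
    (hS_disj : Pairwise fun i j => Disjoint (S i) (S j))
    (hS_cover : ⋃ j, S j = univ)
    (ψ : ∀ j, Lp ℂ 2 (volume.restrict (S j)))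
    (hψ_norm : ∀ j, ‖ψ j‖ = 1)
    (hψ_int : ∀ j, ∫ x in S j, ψ j x ≠ 0)
    (δ : Fin k → ℝ) (hδ_pos : ∀ j, 0 < δ j)
    (hδ : ∀ j, ∀ f : Lp ℂ 2 (volume.restrict (S j)), ∫ x in S j, f x = 0 →
      δ j * ‖f‖ ≤ ‖SpectralCalculus.opSqrt (w.laplacianOn (S j)) f‖)
    (θ δmin : ℝ)
    (hθ : IsGreatest (range fun j => volume.real (S j) / ‖∫ x in S j, ψ j x‖ ^ 2) θ)
    (hδmin : IsLeast (range δ) δmin)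
    (γ : ℝ) (hγ_pos : 0 < γ) (hγ : γ < δmin ^ 2 / θ)
    (f : Lp ℂ 2 (volume : Measure unitInterval)) (hf : f ∈ w.paleyWiener γ) :
    (δmin - Real.sqrt (θ * γ)) ^ 2 / (θ * δmin ^ 2) * ‖f‖ ^ 2
        ≤ ∑ j, ‖∫ x in S j, f x * starRingEnd ℂ (ψ j x)‖ ^ 2 ∧
      ∑ j, ‖∫ x in S j, f x * starRingEnd ℂ (ψ j x)‖ ^ 2 ≤ ‖f‖ ^ 2 := by
  have hδm : 0 < δmin := by
    obtain ⟨j, hj⟩ := hδmin.1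
    exact hj ▸ hδ_pos j
  -- If θ ≤ 0 then δ²/θ ≤ 0 (also for θ = 0, where the quotient is 0 by convention), leaving no room
  -- for a positive γ.
  have hθ0 : 0 < θ := by
    by_contra h
    exact absurd (hγ_pos.trans hγ)
      (not_lt.mpr (div_nonpos_of_nonneg_of_nonpos (sq_nonneg _) (not_lt.mp h)))
  have hfm : MemLp f 2 volume := Lp.memLp f
  let g : ∀ j, Lp ℂ 2 (volume.restrict (S j)) := fun j => (hfm.restrict (S j)).toLp
  have hg : ∀ j, g j =ᵐ[volume.restrict (S j)] f := fun j => MemLp.coeFn_toLp _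
  have hgψ : ∀ j, ∫ x in S j, f x * starRingEnd ℂ (ψ j x) = ⟪ψ j, g j⟫_ℂ := fun j => by
    rw [L2.inner_def]
    refine integral_congr_ae ?_
    filter_upwards [hg j] with x hx
    rw [RCLike.inner_apply, hx]
  have hgnorm : ∀ j, ‖g j‖ ^ 2 = ∫ x in S j, ‖f x‖ ^ 2 := fun j => by
    rw [L2_norm_sq_eq_integral]
    refine integral_congr_ae ?_
    filter_upwards [hg j] with x hx
    rw [hx]
  have hnorm : ∑ j, ‖g j‖ ^ 2 = ‖f‖ ^ 2 := by
    simp_rw [hgnorm]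
    rw [L2_norm_sq_eq_integral, ← setIntegral_univ, ← hS_cover,
      integral_iUnion_ae hS_meas (fun i j hij => (hS_disj hij).aedisjoint)
        ((memLp_two_iff_integrable_sq_norm hfm.1).mp hfm).integrableOn, tsum_fintype]
  simp_rw [hgψ]
  refine ⟨?_, ?_⟩
  swap
  -- Upper bound: Cauchy–Schwarz with a unit vector on each piece.
  · rw [← hnorm]
    refine Finset.sum_le_sum fun j _ => ?_
    gcongr
    simpa [hψ_norm j] using norm_inner_le_norm (𝕜 := ℂ) (ψ j) (g j)
  let e : Fin k → ℝ := fun j =>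
    (∫ p in S j ×ˢ S j, w.toFun p * ‖f p.1 - f p.2‖ ^ 2 ∂volume.prod volume) / 2
  have he0 : ∀ j, 0 ≤ e j := fun j => div_nonneg
    (integral_nonneg fun p => mul_nonneg (w.mem_Icc' p).1 (by positivity)) zero_le_two
  have hesum : ∑ j, e j ≤ γ * ‖f‖ ^ 2 := by
    refine le_trans ?_ (w.energy_le_of_mem_paleyWiener hf)
    rw [← Finset.sum_div]
    gcongr
    -- The energy between different pieces is discarded.
    exact sum_setIntegral_le (fun j => (hS_meas j).prod (hS_meas j))
      (fun i j hij => Set.disjoint_prod.mpr (Or.inl (hS_disj hij)))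
      (fun p => mul_nonneg (w.mem_Icc' p).1 (by positivity))
      (integrable_energy w.aemeasurable' w.mem_Icc' hfm)
  have hpart : ∀ j, ‖g j‖ ≤ √θ * ‖⟪ψ j, g j⟫_ℂ‖ + √θ / δmin * √(e j) := fun j => by
    have h := norm_le_of_poincare (w.aemeasurable_restrict (S j)) w.mem_Icc' (w.symm_restrict (S j))
      (hδ_pos j) (hδ j) (hψ_norm j) (hψ_int j) (g j)
    have hE : (∫ p, w.toFun p * ‖g j p.1 - g j p.2‖ ^ 2
        ∂(volume.restrict (S j)).prod (volume.restrict (S j))) / 2 = e j := by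
      simp only [e, ← Measure.prod_restrict]
      congr 1
      refine integral_congr_ae ?_
      filter_upwards [Measure.quasiMeasurePreserving_fst.ae (hg j),
        Measure.quasiMeasurePreserving_snd.ae (hg j)] with p h1 h2
      rw [h1, h2]
    rw [hE, measureReal_restrict_apply_univ] at h
    have hθj : volume.real (S j) / ‖∫ x in S j, ψ j x‖ ^ 2 ≤ θ := hθ.2 ⟨j, rfl⟩
    have hδj : δmin ≤ δ j := hδmin.2 ⟨j, rfl⟩
    have hδj0 : 0 < δ j := hδ_pos j
    calc ‖g j‖ ≤ _ := h
      _ ≤ √θ * (‖⟪ψ j, g j⟫_ℂ‖ + √(e j) / δmin) := by gcongr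
      _ = _ := by ring
  set N := ∑ j, ‖⟪ψ j, g j⟫_ℂ‖ ^ 2 with hN
  have hN0 : 0 ≤ N := by positivity
  have hmain : ‖f‖ ≤ √θ * √N + √(θ * γ) / δmin * ‖f‖ := by
    calc ‖f‖ = √(∑ j, ‖g j‖ ^ 2) := by rw [hnorm, Real.sqrt_sq (norm_nonneg _)]
      _ ≤ √(∑ j, (√θ * ‖⟪ψ j, g j⟫_ℂ‖ + √θ / δmin * √(e j)) ^ 2) := by
        gcongr with j
        exact hpart j
      _ ≤ _ := sum_sq_add_le_sqrt _ _
      _ = √θ * √N + √θ / δmin * √(∑ j, e j) := by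
        simp_rw [mul_pow, ← Finset.mul_sum, Real.sq_sqrt (he0 _)]
        rw [Real.sqrt_mul (sq_nonneg _), Real.sqrt_mul (sq_nonneg _), Real.sqrt_sq (by positivity),
          Real.sqrt_sq (by positivity)]
      _ ≤ √θ * √N + √θ / δmin * √(γ * ‖f‖ ^ 2) := by gcongr
      _ = _ := by
        rw [Real.sqrt_mul hγ_pos.le, Real.sqrt_sq (norm_nonneg _), Real.sqrt_mul hθ0.le]
        ring
  -- The upper bound on γ enters here: it gives the sign that allows `hlin` to be squared.
  have hlt : √(θ * γ) ≤ δmin := by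
    rw [lt_div_iff₀ hθ0] at hγ
    exact Real.sqrt_le_iff.mpr ⟨hδm.le, by linarith⟩
  have hlin : (δmin - √(θ * γ)) * ‖f‖ ≤ δmin * (√θ * √N) := by
    have h : δmin * ‖f‖ ≤ δmin * (√θ * √N + √(θ * γ) / δmin * ‖f‖) := by gcongr
    have h2 : δmin * (√θ * √N + √(θ * γ) / δmin * ‖f‖) =
      δmin * (√θ * √N) + √(θ * γ) * ‖f‖ := by field_simp
    linarith
  have hsq := pow_le_pow_left₀ (mul_nonneg (sub_nonneg.mpr hlt) (norm_nonneg f)) hlin 2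
  rw [mul_pow, mul_pow, mul_pow, Real.sq_sqrt hθ0.le, Real.sq_sqrt hN0] at hsq
  rw [div_mul_eq_mul_div, div_le_iff₀ (by positivity)]
  linarith
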